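/- For a finite graph $H$ on $h\ge 1$ vertices and real numbers $\varepsilon>0$, $\gamma\in[0,1]$, let $\delta(\varepsilon,H;\gamma)$ be the maximum $\delta\in[0,1]$ such that, for every $n$, every $n$-vertex graph with minimum degree at least $\gamma n$ and with fewer than $\delta n^{h}$ copies of $H$ (subgraphs isomorphic to $H$) can be made $H$-free by deleting at most $\varepsilon n^2$ edges. The \emph{polynomial removal threshold} of $H$ is \[ \delta_{\mathrm{poly\text{-}rem}}(H)=\inf\{\gamma\in[0,1] : \text{there exists } \mu>0 \text{ such that } \delta(\varepsilon,H;\gamma)\ge \mu\,\varepsilon^{1/\mu} \text{ for all } \varepsilon\in(0,1)\}. \] Theorem. For every positive integer $k$, the cycle $C_{2k+1}$ on $2k+1$ vertices satisfies \[ \delta_{\mathrm{poly\text{-}rem}}(C_{2k+1})\ge \frac{1}{2k+1}. \] -/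

import Mathlib

open scoped Classical in
/-- `δ` is admissible for `(ε, H; γ)`: every `n`-vertex graph with minimum degree at least `γ n` and
fewer than `δ n ^ |V(H)|` copies of `H` (subgraphs isomorphic to `H`) can be made `H`-free by
deleting at most `ε n ^ 2` edges. -/
def RemovalAdmissible {W : Type*} [Fintype W] (H : SimpleGraph W) (ε γ δ : ℝ) : Prop :=
  ∀ (n : ℕ) (G : SimpleGraph (Fin n)),
    γ * (n : ℝ) ≤ (G.minDegree : ℝ) →
    (G.copyCount H : ℝ) < δ * (n : ℝ) ^ Fintype.card W →
    ∃ S : Finset (Sym2 (Fin n)), (S : Set (Sym2 (Fin n))) ⊆ G.edgeSet ∧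
      (S.card : ℝ) ≤ ε * (n : ℝ) ^ 2 ∧
      H.Free (G.deleteEdges (S : Set (Sym2 (Fin n))))

/-- The minimum-degree removal function `δ(ε, H; γ)`: the maximum admissible `δ ∈ [0, 1]`
(the supremum is attained, see `isGreatest_removalDelta`). -/
noncomputable def removalDelta {W : Type*} [Fintype W] (H : SimpleGraph W) (ε γ : ℝ) : ℝ :=
  sSup {δ : ℝ | δ ∈ Set.Icc (0 : ℝ) 1 ∧ RemovalAdmissible H ε γ δ}

/-- The supremum defining `removalDelta` is a maximum. -/
theorem isGreatest_removalDelta {W : Type*} [Fintype W] (H : SimpleGraph W) (ε γ : ℝ) :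
    IsGreatest {δ : ℝ | δ ∈ Set.Icc (0 : ℝ) 1 ∧ RemovalAdmissible H ε γ δ}
      (removalDelta H ε γ) := by
  have hne : {δ : ℝ | δ ∈ Set.Icc (0 : ℝ) 1 ∧ RemovalAdmissible H ε γ δ}.Nonempty := by
    refine ⟨0, by simp, fun n G _ h => ?_⟩
    rw [zero_mul] at h
    exact absurd h (not_lt.mpr (Nat.cast_nonneg _))
  have hbd : BddAbove {δ : ℝ | δ ∈ Set.Icc (0 : ℝ) 1 ∧ RemovalAdmissible H ε γ δ} :=
    ⟨1, fun δ hδ => hδ.1.2⟩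
  refine ⟨⟨⟨?_, csSup_le hne fun δ hδ => hδ.1.2⟩, ?_⟩, fun δ hδ => le_csSup hbd hδ⟩
  · obtain ⟨δ, hδ⟩ := hne
    exact hδ.1.1.trans (le_csSup hbd hδ)
  · intro n G hdeg hcop
    have hpos : 0 < (n : ℝ) ^ Fintype.card W := by
      rcases (pow_nonneg (Nat.cast_nonneg n) _ : 0 ≤ (n : ℝ) ^ Fintype.card W).eq_or_lt with h | h
      · rw [← h, mul_zero] at hcop
        exact absurd hcop (not_lt.mpr (Nat.cast_nonneg _))
      · exact h
    obtain ⟨δ, hδ, hlt⟩ := exists_lt_of_lt_csSup hne ((div_lt_iff₀ hpos).mpr hcop)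
    exact hδ.2 n G hdeg ((div_lt_iff₀ hpos).mp hlt)

/-- The polynomial removal threshold of `H`. The set always contains `γ = 1` when `H` has a vertex
(see `one_mem_polyRem_set`), so this is a genuine infimum. -/
noncomputable def polyRem {W : Type*} [Fintype W] (H : SimpleGraph W) : ℝ :=
  sInf {γ : ℝ | γ ∈ Set.Icc (0 : ℝ) 1 ∧
    ∃ μ : ℝ, 0 < μ ∧ ∀ ε ∈ Set.Ioo (0 : ℝ) 1, μ * ε ^ (1 / μ) ≤ removalDelta H ε γ}

/-- The set whose infimum is `polyRem H` is nonempty. -/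
theorem one_mem_polyRem_set {W : Type*} [Fintype W] [Nonempty W] (H : SimpleGraph W) :
    (1 : ℝ) ∈ {γ : ℝ | γ ∈ Set.Icc (0 : ℝ) 1 ∧
      ∃ μ : ℝ, 0 < μ ∧ ∀ ε ∈ Set.Ioo (0 : ℝ) 1, μ * ε ^ (1 / μ) ≤ removalDelta H ε γ} := by
  refine ⟨by simp, 1, one_pos, fun ε hε => ?_⟩
  have h1 : (1 : ℝ) ≤ removalDelta H ε 1 := by
    refine (isGreatest_removalDelta H ε 1).2 ⟨by simp, fun n G hdeg hcop => ?_⟩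
    exfalso
    rcases Nat.eq_zero_or_pos n with rfl | hn
    · rw [Nat.cast_zero, zero_pow Fintype.card_ne_zero, mul_zero] at hcop
      exact absurd hcop (not_lt.mpr (Nat.cast_nonneg _))
    · classical
      have hd : n ≤ G.minDegree := by
        rw [one_mul] at hdeg
        convert (Nat.cast_le (α := ℝ)).mp hdeg
      have h2 := G.minDegree_le_degree ⟨0, hn⟩
      have h3 := G.degree_lt_card_verts ⟨0, hn⟩
      rw [Fintype.card_fin] at h3
      omega
  have := hε.2
  simp only [div_one, Real.rpow_one, one_mul]
  linarith

/-! Put `N = 2k+1` and `γ < 1/N`. It suffices to find graphs of minimum degree at least `γ n` that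
are far from `C_N`-free and yet contain few copies. The `X` layers carry a Behrend-type
(Ruzsa–Szemerédi) packing of edge-disjoint `N`-cycles; the much larger `Y` layers supply the degree,
nearly `n / N` each. The `Y` layers create no `N`-cycle. Along an edge the layer index changes by `e
∈ {-1, 0, 1}`, and the side `X`/`Y` switches exactly when `e = 0`. In a closed walk of odd length
`N`, the sum of the `e` is odd and divisible by `N`, so all `e` are `1` or all are `-1`. Such a walk
never changes side, and it must cross the gap of the `Y` path, so it stays in `X`
(`layeredGraph_closedWalk`). Inside `X`, rigidity leaves only the planted cycles: if progressions
with differences on a sphere glue to a closed walk, one difference is the mean of all of them, so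
they coincide (`isRigidFamily_progressionFamily`). In fixed dimension `D`, this gives `ε` of order
at least `d ^ (-2)` but `δ` of order at most `d ^ (-D)`; `D` is arbitrary, so no polynomial bound
survives. -/

/-- Let `P t 0, …, P t (N - 1)` be a family of closed walks of length `N`. The graph consists of `N`
layers `X` carrying these walks, one per index `i : ZMod N`, of `N` further layers `Y` forming the
blow-up of a path, and of all edges between the layers `X` and `Y` of equal index. -/
def layeredGraph {N : ℕ} {T X : Type*} (P : T → ZMod N → X) (Y : Type*) :
    SimpleGraph (ZMod N × (X ⊕ Y)) :=
  SimpleGraph.fromRel fun p q =>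
    match p, q with
    | (i, .inl x), (j, .inl y) => j = i + 1 ∧ ∃ t, x = P t i ∧ y = P t j
    | (i, .inl _), (j, .inr _) => i = j
    | (i, .inr _), (j, .inr _) => j = i + 1 ∧ i ≠ -1
    | (_, .inr _), (_, .inl _) => False

/-- A family of closed walks that admits no closed walk other than its members: if consecutive
edges are taken from possibly different members, then all of them are from the same member. -/
def IsRigidFamily {N : ℕ} {T X : Type*} (P : T → ZMod N → X) : Prop :=
  ∀ τ : ZMod N → T, (∀ i, P (τ i) (i + 1) = P (τ (i + 1)) (i + 1)) → ∀ i j, τ i = τ j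

/-! ### Closed walks of odd length in the layered graph -/

section LayeredGraph

variable {N : ℕ} {T X Y : Type*} {P : T → ZMod N → X}

/-- Two members of a rigid family that share an edge are equal. -/
theorem IsRigidFamily.eq_of_edge_eq (hP : IsRigidFamily P) (hN : 1 < N) {t t' : T} {i : ZMod N}
    (h₀ : P t i = P t' i) (h₁ : P t (i + 1) = P t' (i + 1)) : t = t' := by
  have : Fact (1 < N) := ⟨hN⟩
  have hi : i + 1 ≠ i := by simp
  -- Replacing edge `i` of `t` by that of `t'` keeps the walk closed.
  have key := hP (fun j => if j = i then t' else t) (fun j => ?_) (i + 1) i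
  · simpa [hi] using key
  · by_cases hj : j = i
    · subst hj; simp [h₁]
    · by_cases hj' : j + 1 = i
      · simp [hj, hj', h₀]
      · simp [hj, hj']

/-- `0` on the layers `X` and `1` on the layers `Y`. -/
def layerSide : ZMod N × (X ⊕ Y) → ZMod 2 := fun p => Sum.elim (fun _ => 0) (fun _ => 1) p.2

/-- The step `e` is an integer so that its sum around a walk can be read both modulo `N` and modulo
2. -/
theorem layeredGraph_adj_step {p q : ZMod N × (X ⊕ Y)} (h : (layeredGraph P Y).Adj p q) :
    ∃ e : ℤ, |e| ≤ 1 ∧ q.1 - p.1 = e ∧ layerSide q - layerSide p = 1 + e := by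
  have two : (1 : ZMod 2) + 1 = 0 := by decide
  have negone : (-1 : ZMod 2) = 1 := by decide
  obtain ⟨i, x | x⟩ := p <;> obtain ⟨j, y | y⟩ := q <;>
    simp only [layeredGraph, SimpleGraph.fromRel_adj] at h <;>
    obtain ⟨-, h | h⟩ := h
  · exact ⟨1, by simp, by simp [h.1], by simp [layerSide, two]⟩
  · exact ⟨-1, by simp, by simp [h.1], by simp [layerSide, negone, two]⟩
  · exact ⟨0, by simp, by simp [h], by simp [layerSide]⟩
  · exact h.elim
  · exact h.elim
  · exact ⟨0, by simp, by simp [h], by simp [layerSide, negone]⟩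
  · exact ⟨1, by simp, by simp [h.1], by simp [layerSide, two]⟩
  · exact ⟨-1, by simp, by simp [h.1], by simp [layerSide, negone, two]⟩

theorem layeredGraph_adj_succ (hN : 2 < N) {i : ZMod N} {x y : X ⊕ Y}
    (h : (layeredGraph P Y).Adj (i, x) (i + 1, y)) :
    (∃ t, x = .inl (P t i) ∧ y = .inl (P t (i + 1))) ∨
      (i ≠ -1 ∧ x.isRight ∧ y.isRight) := by
  have : Fact (1 < N) := ⟨by omega⟩
  have h2 : (2 : ZMod N) ≠ 0 := by
    intro h
    have := (ZMod.natCast_eq_zero_iff 2 N).1 (by exact_mod_cast h)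
    exact absurd (Nat.le_of_dvd (by norm_num) this) (by omega)
  have h2' : i ≠ i + 1 + 1 := by
    intro h
    apply h2
    linear_combination -h
  rcases x with x | x <;> rcases y with y | y <;>
    simp only [layeredGraph, SimpleGraph.fromRel_adj] at h <;>
    obtain ⟨-, h | h⟩ := h
  · obtain ⟨-, t, rfl, rfl⟩ := h
    exact .inl ⟨t, rfl, rfl⟩
  · exact absurd h.1 h2'
  · simp at h
  · exact h.elim
  · exact h.elim
  · simp at h
  · exact .inr ⟨h.2, rfl, rfl⟩
  · exact absurd h.1 h2'

/-- A closed walk that moves up by one layer in each step is a member of the family. -/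
theorem layeredGraph_transversal (hN : 2 < N) (hP : IsRigidFamily P) {g : ZMod N → X ⊕ Y}
    (h : ∀ i, (layeredGraph P Y).Adj (i, g i) (i + 1, g (i + 1))) :
    ∃ t, ∀ i, g i = .inl (P t i) := by
  have hl : ∀ i, ∃ t, g i = .inl (P t i) ∧ g (i + 1) = .inl (P t (i + 1)) := by
    -- `Y` has no edge from layer `-1` to layer `0`, so the walk is in `X` there; upward steps then
    -- keep it in `X`.
    have h0 : ∃ t, g (-1) = .inl (P t (-1)) ∧ g (-1 + 1) = .inl (P t (-1 + 1)) :=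
      (layeredGraph_adj_succ hN (h (-1))).resolve_right (by simp)
    have hn : ∀ n : ℕ, ∃ t, g n = .inl (P t n) ∧ g (n + 1) = .inl (P t (n + 1)) := by
      intro n
      induction n with
      | zero =>
        obtain ⟨t, -, ht⟩ := h0
        refine (layeredGraph_adj_succ hN (h _)).resolve_right ?_
        rintro ⟨-, hr, -⟩
        rw [neg_add_cancel] at ht
        simp [ht] at hr
      | succ n ih =>
        obtain ⟨t, -, ht⟩ := ih
        refine (layeredGraph_adj_succ hN (h _)).resolve_right ?_
        rintro ⟨-, hr, -⟩
        push_cast at hr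
        simp [ht] at hr
    intro i
    have : NeZero N := ⟨by omega⟩
    simpa using hn i.val
  choose τ hτ hτ' using hl
  have hc := hP τ fun i => Sum.inl_injective ((hτ' i).symm.trans (hτ (i + 1)))
  exact ⟨τ 0, fun i => by rw [hτ i, hc i 0]⟩

/-- Integers in `[-1, 1]` indexed by `ZMod N` whose sum is odd and divisible by `N`,
are all `1` or all `-1`. -/
theorem forall_eq_of_sum_odd_dvd [NeZero N] {e : ZMod N → ℤ} (he : ∀ j, |e j| ≤ 1)
    (hodd : Odd (∑ j, e j)) (hdvd : (N : ℤ) ∣ ∑ j, e j) :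
    (∀ j, e j = 1) ∨ (∀ j, e j = -1) := by
  have hpos : (0 : ℤ) < N := by exact_mod_cast NeZero.pos N
  have habs := Int.le_of_dvd (by
    rw [abs_pos]
    rintro h
    simp [h] at hodd) ((dvd_abs _ _).2 hdvd)
  have hcard : (∑ _j : ZMod N, (1 : ℤ)) = N := by simp [ZMod.card]
  rcases le_abs.1 habs with h | h
  · left
    have hle : ∀ j ∈ Finset.univ, e j ≤ 1 := fun j _ => (abs_le.1 (he j)).2
    have := (Finset.sum_eq_sum_iff_of_le hle).1
      (le_antisymm (Finset.sum_le_sum hle) (hcard.trans_le h))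
    exact fun j => this j (Finset.mem_univ j)
  · right
    have hle : ∀ j ∈ Finset.univ, -e j ≤ 1 := fun j _ => by
      linarith [(abs_le.1 (he j)).1]
    have := (Finset.sum_eq_sum_iff_of_le hle).1
      (le_antisymm (Finset.sum_le_sum hle) (hcard.trans_le (by simpa using h)))
    exact fun j => by linarith [this j (Finset.mem_univ j)]

/-- Every closed walk of odd length `N` is a member of the family, up to rotation and reflection. -/
theorem layeredGraph_closedWalk (hN : 2 < N) (hodd : Odd N) (hP : IsRigidFamily P)
    {f : ZMod N → ZMod N × (X ⊕ Y)} (h : ∀ j, (layeredGraph P Y).Adj (f j) (f (j + 1))) :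
    ∃ (σ : ℤˣ) (i : ZMod N) (t : T),
      ∀ j, f j = (i + (σ : ℤ) * j, .inl (P t (i + (σ : ℤ) * j))) := by
  have : NeZero N := ⟨by omega⟩
  choose e he hidx hside using fun j => layeredGraph_adj_step (h j)
  have htel : ∀ {M : Type} [AddCommGroup M] (φ : ZMod N → M), ∑ j, (φ (j + 1) - φ j) = 0 := by
    intro M _ φ
    rw [Finset.sum_sub_distrib, sub_eq_zero]
    exact Equiv.sum_comp (Equiv.addRight (1 : ZMod N)) φ
  have hdvd : (N : ℤ) ∣ ∑ j, e j := by
    rw [← ZMod.intCast_zmod_eq_zero_iff_dvd, Int.cast_sum, ← htel fun j => (f j).1]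
    exact Finset.sum_congr rfl fun j _ => (hidx j).symm
  have hso : Odd (∑ j, e j) := by
    have h0 : ((∑ j, (1 + e j) : ℤ) : ZMod 2) = 0 := by
      rw [Int.cast_sum, ← htel fun j => layerSide (f j)]
      exact Finset.sum_congr rfl fun j _ => by rw [hside j]; push_cast; rfl
    rw [ZMod.intCast_zmod_eq_zero_iff_dvd, Finset.sum_add_distrib] at h0
    have h1 : (∑ _j : ZMod N, (1 : ℤ)) = N := by simp [ZMod.card]
    rw [h1] at h0
    have h2 : Odd (N : ℤ) := by exact_mod_cast hodd
    exact (Int.even_add'.1 (even_iff_two_dvd.2 h0)).1 h2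
  have hsign : ∃ σ : ℤˣ, ∀ j, e j = σ := by
    rcases forall_eq_of_sum_odd_dvd he hso hdvd with h | h
    · exact ⟨1, by simpa using h⟩
    · exact ⟨-1, by simpa using h⟩
  obtain ⟨σ, hσ⟩ := hsign
  have hσσ : ((σ : ℤ) : ZMod N) * ((σ : ℤ) : ZMod N) = 1 := by
    rw [← Int.cast_mul, ← Units.val_mul, Int.units_mul_self]; simp
  have hfst : ∀ j, (f j).1 = (f 0).1 + (σ : ℤ) * j := by
    have hn : ∀ n : ℕ, (f n).1 = (f 0).1 + (σ : ℤ) * n := by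
      intro n
      induction n with
      | zero => simp
      | succ n ih =>
        have := hidx n
        rw [hσ] at this
        push_cast
        linear_combination this + ih
    intro j
    simpa using hn j.val
  -- The time at which the walk visits layer `i`; reparametrised by `r`, the walk moves up.
  let r : ZMod N → ZMod N := fun i => (σ : ℤ) * (i - (f 0).1)
  have hr : ∀ i, (f (r i)).1 = i := fun i => by
    rw [hfst]
    simp only [r]
    linear_combination (i - (f 0).1) * hσσ
  have hr' : ∀ j, r ((f 0).1 + (σ : ℤ) * j) = j := fun j => by
    simp only [r]
    linear_combination j * hσσ
  have hpair : ∀ i, f (r i) = (i, (f (r i)).2) := fun i => Prod.ext (hr i) rfl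
  obtain ⟨t, ht⟩ := layeredGraph_transversal (Y := Y) hN hP (g := fun i => (f (r i)).2) fun i => by
    rw [← hpair, ← hpair]
    have hstep : r (i + 1) = r i + (σ : ℤ) := by simp only [r]; ring
    rw [hstep]
    rcases Int.units_eq_one_or σ with rfl | rfl
    · simpa using h (r i)
    · simpa [← sub_eq_add_neg] using (h (r i - 1)).symm
  refine ⟨σ, (f 0).1, t, fun j => ?_⟩
  rw [← ht, hr', ← hfst]

/-- The closed walk `P t` in the layers `X`. -/
theorem layeredGraph_adj_member (hN : 1 < N) (t : T) (i : ZMod N) :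
    (layeredGraph P Y).Adj (i, .inl (P t i)) (i + 1, .inl (P t (i + 1))) := by
  have : Fact (1 < N) := ⟨hN⟩
  simp only [layeredGraph, SimpleGraph.fromRel_adj]
  exact ⟨by simp, .inl ⟨trivial, t, rfl, rfl⟩⟩

/-- Edges of the members of a rigid family are pairwise distinct. -/
theorem IsRigidFamily.eq_of_sym2_eq (hN : 2 < N) (hP : IsRigidFamily P) {t t' : T}
    {i j : ZMod N}
    (h : s((i, Sum.inl (P t i)), (i + 1, Sum.inl (P t (i + 1)))) =
      (s((j, .inl (P t' j)), (j + 1, .inl (P t' (j + 1)))) : Sym2 (ZMod N × (X ⊕ Y)))) :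
    t = t' := by
  have h2 : (2 : ZMod N) ≠ 0 := by
    intro h
    have := (ZMod.natCast_eq_zero_iff 2 N).1 (by exact_mod_cast h)
    exact absurd (Nat.le_of_dvd (by norm_num) this) (by omega)
  rw [Sym2.eq_iff] at h
  simp only [Prod.mk.injEq, Sum.inl.injEq] at h
  rcases h with ⟨⟨rfl, h₀⟩, -, h₁⟩ | ⟨⟨h₀, -⟩, h₁, -⟩
  · exact hP.eq_of_edge_eq (by omega) h₀ h₁
  · refine absurd ?_ h2
    linear_combination h₁ - h₀

/-- Every vertex is adjacent to a whole layer `Y`. -/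
theorem layeredGraph_exists_layer (hN : 1 < N) (p : ZMod N × (X ⊕ Y)) :
    ∃ i : ZMod N, ∀ y : Y, (layeredGraph P Y).Adj p (i, .inr y) := by
  have : Fact (1 < N) := ⟨hN⟩
  obtain ⟨i, x | x⟩ := p
  · exact ⟨i, fun y => by simp [layeredGraph]⟩
  · by_cases hi : i = -1
    · refine ⟨i - 1, fun y => ?_⟩
      have h1 : i - 1 ≠ -1 := by simp [hi]
      have h2 : i ≠ i - 1 := fun h => one_ne_zero (α := ZMod N) (by linear_combination h)
      simp only [layeredGraph, SimpleGraph.fromRel_adj]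
      exact ⟨by simp [h2], .inr ⟨by ring, h1⟩⟩
    · refine ⟨i + 1, fun y => ?_⟩
      simp only [layeredGraph, SimpleGraph.fromRel_adj]
      exact ⟨by simp, .inl ⟨trivial, hi⟩⟩

end LayeredGraph

/-! ### Copies of the cycle, edge deletions and minimum degree -/

theorem SimpleGraph.labelledCopyCount_eq_natCard {V W : Type*} [Fintype V] [Fintype W]
    (G : SimpleGraph V) (H : SimpleGraph W) : G.labelledCopyCount H = Nat.card (H.Copy G) := by
  classical
  rw [SimpleGraph.labelledCopyCount, Nat.card_eq_fintype_card]

section Transfer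

variable {k : ℕ} {T X Y : Type*} {P : T → ZMod (2 * k + 1) → X}

theorem cycleGraph_adj_iff_finEquiv (hk : 0 < k) {u v : Fin (2 * k + 1)} :
    (SimpleGraph.cycleGraph (2 * k + 1)).Adj u v ↔
      ZMod.finEquiv (2 * k + 1) u = ZMod.finEquiv (2 * k + 1) v + 1 ∨
        ZMod.finEquiv (2 * k + 1) v = ZMod.finEquiv (2 * k + 1) u + 1 := by
  have h1 : Fact (1 < 2 * k + 1) := ⟨by omega⟩
  have key : ∀ a b : Fin (2 * k + 1), (a - b).val = 1 ↔
      ZMod.finEquiv (2 * k + 1) a = ZMod.finEquiv (2 * k + 1) b + 1 := fun a b => by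
    have h3 : (a - b).val = (ZMod.finEquiv (2 * k + 1) a - ZMod.finEquiv (2 * k + 1) b).val := rfl
    rw [h3, ← sub_eq_iff_eq_add', ← (ZMod.val_injective (2 * k + 1)).eq_iff,
      ZMod.val_one (2 * k + 1)]
  rw [SimpleGraph.cycleGraph_adj', key, key]

theorem cycleGraph_adj_finEquiv_symm (hk : 0 < k) (j : ZMod (2 * k + 1)) :
    (SimpleGraph.cycleGraph (2 * k + 1)).Adj ((ZMod.finEquiv (2 * k + 1)).symm j)
      ((ZMod.finEquiv (2 * k + 1)).symm (j + 1)) := by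
  rw [cycleGraph_adj_iff_finEquiv hk, RingEquiv.apply_symm_apply, RingEquiv.apply_symm_apply]
  exact .inr rfl

variable {n : ℕ} (e : Fin n ≃ ZMod (2 * k + 1) × (X ⊕ Y))

/-- A labelled copy is determined by a reflection sign, a starting layer and a member. -/
theorem copyCount_comap_layeredGraph_le [Fintype T] (hk : 0 < k) (hP : IsRigidFamily P) :
    ((layeredGraph P Y).comap e).copyCount (SimpleGraph.cycleGraph (2 * k + 1)) ≤
      2 * (2 * k + 1) * Fintype.card T := by
  classical
  refine SimpleGraph.copyCount_le_labelledCopyCount.trans ?_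
  have hex : ∀ f : SimpleGraph.Copy (SimpleGraph.cycleGraph (2 * k + 1))
      ((layeredGraph P Y).comap e), ∃ c : ℤˣ × ZMod (2 * k + 1) × T, ∀ j : ZMod (2 * k + 1),
      e (f ((ZMod.finEquiv (2 * k + 1)).symm j)) =
        (c.2.1 + (c.1 : ℤ) * j, .inl (P c.2.2 (c.2.1 + (c.1 : ℤ) * j))) := by
    intro f
    obtain ⟨σ, i, t, h⟩ := layeredGraph_closedWalk (P := P) (Y := Y) (by omega) ⟨k, rfl⟩ hP
      (f := fun j => e (f ((ZMod.finEquiv (2 * k + 1)).symm j)))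
      fun j => f.toHom.map_adj (cycleGraph_adj_finEquiv_symm hk j)
    exact ⟨(σ, i, t), h⟩
  choose c hc using hex
  have hinj : Function.Injective c := fun f g hfg => by
    apply DFunLike.ext
    intro u
    apply e.injective
    have := (hc f (ZMod.finEquiv _ u)).trans (hfg ▸ (hc g (ZMod.finEquiv _ u)).symm)
    simpa only [RingEquiv.symm_apply_apply] using this
  calc _ = Nat.card (SimpleGraph.Copy (SimpleGraph.cycleGraph (2 * k + 1))
          ((layeredGraph P Y).comap e)) := by
        rw [SimpleGraph.labelledCopyCount_eq_natCard]
    _ ≤ Nat.card (ℤˣ × ZMod (2 * k + 1) × T) := Nat.card_le_card_of_injective c hinj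
    _ = 2 * (2 * k + 1) * Fintype.card T := by
        rw [Nat.card_prod, Nat.card_prod, Nat.card_zmod, Nat.card_eq_fintype_card,
          Nat.card_eq_fintype_card, Fintype.card_units_int, mul_assoc]

/-- The members are edge-disjoint cycles, and each must lose an edge. -/
theorem card_le_of_free_deleteEdges_comap [Fintype T] (hk : 0 < k) (hP : IsRigidFamily P)
    {S : Finset (Sym2 (Fin n))}
    (hS : (SimpleGraph.cycleGraph (2 * k + 1)).Free
      (((layeredGraph P Y).comap e).deleteEdges (S : Set (Sym2 (Fin n))))) :
    Fintype.card T ≤ S.card := by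
  have hex : ∀ t : T, ∃ i : ZMod (2 * k + 1),
      s(e.symm (i, .inl (P t i)), e.symm (i + 1, .inl (P t (i + 1)))) ∈ S := by
    intro t
    by_contra! hcon
    have hadj : ∀ i : ZMod (2 * k + 1),
        (((layeredGraph P Y).comap e).deleteEdges (S : Set (Sym2 (Fin n)))).Adj
          (e.symm (i, .inl (P t i))) (e.symm (i + 1, .inl (P t (i + 1)))) := by
      intro i
      rw [SimpleGraph.deleteEdges_adj]
      refine ⟨?_, by exact_mod_cast hcon i⟩
      simpa using layeredGraph_adj_member (P := P) (Y := Y) (by omega) t i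
    refine hS ⟨⟨⟨fun u => e.symm (ZMod.finEquiv _ u, .inl (P t (ZMod.finEquiv _ u))), ?_⟩, ?_⟩⟩
    · intro u v huv
      rcases (cycleGraph_adj_iff_finEquiv hk).1 huv with h | h
      · rw [h]
        exact (hadj _).symm
      · rw [h]
        exact hadj _
    · intro u v huv
      exact (ZMod.finEquiv _).injective (Prod.ext_iff.1 (e.symm.injective huv)).1
  choose i hi using hex
  have hinj : Function.Injective fun t => s(e.symm (i t, .inl (P t (i t))),
      e.symm (i t + 1, .inl (P t (i t + 1)))) := by
    intro t t' h
    have h' := congrArg (Sym2.map e) h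
    simp only [Sym2.map_mk, Equiv.apply_symm_apply] at h'
    exact hP.eq_of_sym2_eq (by omega) h'
  rw [← Finset.card_univ]
  exact Finset.card_le_card_of_injOn _ (fun t _ => hi t) hinj.injOn

theorem card_le_minDegree_comap_layeredGraph [Fintype Y] (hk : 0 < k) [Nonempty (Fin n)]
    [DecidableRel ((layeredGraph P Y).comap e).Adj] :
    Fintype.card Y ≤ ((layeredGraph P Y).comap e).minDegree := by
  refine SimpleGraph.le_minDegree_of_forall_le_degree _ _ fun v => ?_
  obtain ⟨i, hi⟩ := layeredGraph_exists_layer (P := P) (Y := Y) (by omega) (e v)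
  rw [← Finset.card_univ, ← SimpleGraph.card_neighborFinset_eq_degree]
  refine Finset.card_le_card_of_injOn (fun y => e.symm (i, .inr y)) (fun y _ => ?_) ?_
  · simpa using hi y
  · intro y _ y' _ h
    simpa using h

end Transfer

/-! ### Rigidity of progressions with differences on a sphere -/

/-- The arithmetic progressions `x, x + s, …, x + (N - 1) s` in `(ZMod M) ^ D` with `s ∈ S`. -/
def progressionFamily (N M : ℕ) {D : ℕ} (S : Finset (Fin D → ℕ)) :
    (Fin D → ZMod M) × S → ZMod N → (Fin D → ZMod M) :=
  fun p i c => p.1 c + i.val * (p.2.1 c : ZMod M)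

theorem ZMod.val_add_one_cast {N : ℕ} (hN : 1 < N) {A : Type*} [Ring A] (i : ZMod N) :
    (((i + 1).val : ℕ) : A) = i.val + 1 - if i = -1 then (N : A) else 0 := by
  have : Fact (1 < N) := ⟨hN⟩
  have : NeZero N := ⟨by omega⟩
  by_cases hi : i = -1
  · subst hi
    obtain ⟨n, rfl⟩ : ∃ n, N = n + 1 := ⟨N - 1, by omega⟩
    rw [neg_add_cancel, ZMod.val_zero, ZMod.val_neg_one]
    simp
  · have hlt : i.val + (1 : ZMod N).val < N := by
      rw [ZMod.val_one]
      have h1 := ZMod.val_lt i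
      refine lt_of_le_of_ne h1 fun h => hi ?_
      have h2 : ((i.val + 1 : ℕ) : ZMod N) = 0 := by rw [h]; simp
      push_cast at h2
      rw [ZMod.natCast_zmod_val] at h2
      linear_combination h2
    rw [ZMod.val_add_of_lt hlt, ZMod.val_one]
    simp [hi]

/-- Points of a sphere whose mean is one of them coincide. -/
theorem Behrend.eq_of_sum_eq_card_mul {ι : Type*} [Fintype ι] {D d R : ℕ} {s : ι → Fin D → ℕ}
    (hs : ∀ i, s i ∈ Behrend.sphere D d R) (a : ι)
    (h : ∀ c, ∑ i, s i c = Fintype.card ι * s a c) (i : ι) : s i = s a := by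
  have hsq : ∀ i, ∑ c, (s i c : ℤ) ^ 2 = R := fun i => by
    exact_mod_cast (Finset.mem_filter.1 (hs i)).2
  -- Expanding the squares gives `2 * card ι * R` minus twice `card ι * R`, since the inner products
  -- with `s a` sum to `card ι * R`.
  have hsum : ∑ i, ∑ c, ((s i c : ℤ) - s a c) ^ 2 = 0 := by
    calc ∑ i, ∑ c, ((s i c : ℤ) - s a c) ^ 2
        = ∑ i, (∑ c, (s i c : ℤ) ^ 2 + ∑ c, (s a c : ℤ) ^ 2)
            - 2 * ∑ i, ∑ c, (s i c : ℤ) * s a c := by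
          rw [Finset.mul_sum, ← Finset.sum_sub_distrib]
          refine Finset.sum_congr rfl fun i _ => ?_
          rw [Finset.mul_sum, ← Finset.sum_add_distrib, ← Finset.sum_sub_distrib]
          exact Finset.sum_congr rfl fun c _ => by ring
      _ = Fintype.card ι * (2 * R) - 2 * ∑ c, (Fintype.card ι * (s a c : ℤ)) * s a c := by
          rw [Finset.sum_comm (γ := ι)]
          congr 1
          · simp only [hsq, Finset.sum_const, Finset.card_univ, nsmul_eq_mul]
            ring
          · congr 1
            refine Finset.sum_congr rfl fun c _ => ?_
            rw [← Finset.sum_mul]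
            congr 1
            exact_mod_cast h c
      _ = 0 := by
          have : ∑ c, (Fintype.card ι * (s a c : ℤ)) * s a c = Fintype.card ι * R := by
            rw [← hsq a, Finset.mul_sum]
            exact Finset.sum_congr rfl fun c _ => by ring
          rw [this]
          ring
  have h1 := (Finset.sum_eq_zero_iff_of_nonneg fun i _ =>
    Finset.sum_nonneg fun c _ => sq_nonneg _).1 hsum i (Finset.mem_univ i)
  funext c
  have h2 := (Finset.sum_eq_zero_iff_of_nonneg fun c _ => sq_nonneg _).1 h1 c (Finset.mem_univ c)
  have h3 := pow_eq_zero_iff (two_ne_zero) |>.1 h2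
  omega

theorem isRigidFamily_progressionFamily {N : ℕ} (hN : 1 < N) (D d R : ℕ) :
    IsRigidFamily (progressionFamily N (N * d) (Behrend.sphere D d R)) := by
  have : NeZero N := ⟨by omega⟩
  intro τ hτ
  have hbox : ∀ i c, (τ i).2.1 c < d := fun i c =>
    Behrend.mem_box.1 (Behrend.sphere_subset_box (τ i).2.2) c
  have hmod : ∀ c, ((∑ i, (τ i).2.1 c : ℕ) : ZMod (N * d)) = ((N * (τ (-1)).2.1 c : ℕ)) := by
    intro c
    have hshift : ∀ φ : ZMod N → ZMod (N * d), ∑ i, φ (i + 1) = ∑ i, φ i := fun φ =>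
      Equiv.sum_comp (Equiv.addRight (1 : ZMod N)) φ
    -- Summing the gluing conditions cancels the base points; the wrap-around at `-1` leaves `N`
    -- times the difference of `τ (-1)`.
    have h1 : ∑ i, ((τ i).1 c + (i + 1).val * ((τ i).2.1 c : ZMod (N * d))) =
        ∑ i, ((τ i).1 c + i.val * ((τ i).2.1 c : ZMod (N * d))) := by
      rw [← hshift fun i => (τ i).1 c + i.val * ((τ i).2.1 c : ZMod (N * d))]
      exact Finset.sum_congr rfl fun i _ => congrFun (hτ i) c
    rw [Finset.sum_add_distrib, Finset.sum_add_distrib, add_right_inj] at h1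
    simp only [ZMod.val_add_one_cast hN, sub_mul, add_mul, one_mul, Finset.sum_add_distrib,
      Finset.sum_sub_distrib, ite_mul, zero_mul, Finset.sum_ite_eq', Finset.mem_univ,
      if_true] at h1
    push_cast at h1 ⊢
    linear_combination h1
  -- Both sides are below the modulus `N * d`, so the congruence is an equality.
  have hnat : ∀ c, ∑ i, (τ i).2.1 c = Fintype.card (ZMod N) * (τ (-1)).2.1 c := by
    intro c
    have h1 : ∑ i, (τ i).2.1 c < N * d := by
      calc ∑ i, (τ i).2.1 c < ∑ _i : ZMod N, d :=
            Finset.sum_lt_sum_of_nonempty Finset.univ_nonempty fun i _ => hbox i c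
        _ = N * d := by simp [ZMod.card]
    have h2 : N * (τ (-1)).2.1 c < N * d := Nat.mul_lt_mul_of_pos_left (hbox _ c) (by omega)
    rw [ZMod.card]
    exact Nat.ModEq.eq_of_lt_of_lt ((ZMod.natCast_eq_natCast_iff _ _ _).1 (hmod c)) h1 h2
  have hs : ∀ i, (τ i).2 = (τ (-1)).2 := fun i =>
    Subtype.ext (Behrend.eq_of_sum_eq_card_mul (fun i => (τ i).2.2) (-1) hnat i)
  have hstep : ∀ i, τ i = τ (i + 1) := by
    intro i
    refine Prod.ext ?_ ((hs i).trans (hs (i + 1)).symm)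
    funext c
    have h1 : (τ i).1 c + (i + 1).val * ((τ i).2.1 c : ZMod (N * d)) =
        (τ (i + 1)).1 c + (i + 1).val * ((τ (i + 1)).2.1 c : ZMod (N * d)) := congrFun (hτ i) c
    rw [hs i, hs (i + 1)] at h1
    exact add_right_cancel h1
  have hconst : ∀ n : ℕ, τ n = τ 0 := by
    intro n
    induction n with
    | zero => simp
    | succ n ih => rw [← ih, hstep n]; push_cast; rfl
  have hconst' : ∀ i, τ i = τ 0 := fun i => by simpa using hconst i.val
  exact fun i j => (hconst' i).trans (hconst' j).symm

/-! ### Choice of parameters -/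

/-- An admissible `δ` is small, or `ε` is large, by the layered graph of progressions. -/
theorem RemovalAdmissible.card_sphere_le {k : ℕ} (hk : 0 < k) {ε γ δ : ℝ}
    (h : RemovalAdmissible (SimpleGraph.cycleGraph (2 * k + 1)) ε γ δ) {q : ℕ}
    (hq : γ * ((2 * k + 1) * (q + 1)) ≤ q) {D d : ℕ} (hd : 0 < d) (R : ℕ) {m n : ℕ}
    (hm : m = ((2 * k + 1) * d) ^ D) (hn : n = (2 * k + 1) * ((q + 1) * m))
    (hδ : 2 * (2 * k + 1) * (m * (Behrend.sphere D d R).card) < δ * (n : ℝ) ^ (2 * k + 1)) :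
    (m * (Behrend.sphere D d R).card : ℝ) ≤ ε * (n : ℝ) ^ 2 := by
  classical
  have : NeZero ((2 * k + 1) * d) := ⟨by positivity⟩
  let X := Fin D → ZMod ((2 * k + 1) * d)
  let S := Behrend.sphere D d R
  let P : X × S → ZMod (2 * k + 1) → X := progressionFamily (2 * k + 1) ((2 * k + 1) * d) S
  have hP : IsRigidFamily P := isRigidFamily_progressionFamily (by omega) D d R
  have hX : Fintype.card X = m := by simp [X, hm, ZMod.card]
  have hT : Fintype.card (X × S) = m * S.card := by simp [hX]
  have hV : Fintype.card (ZMod (2 * k + 1) × (X ⊕ (Fin q × X))) = n := by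
    rw [Fintype.card_prod, Fintype.card_sum, Fintype.card_prod, hX, ZMod.card, Fintype.card_fin,
      hn]
    ring
  have hn0 : 0 < n := by rw [hn, hm]; positivity
  have : Nonempty (Fin n) := ⟨⟨0, hn0⟩⟩
  let e := (Fintype.equivFinOfCardEq hV).symm
  have hdeg : γ * (n : ℝ) ≤ (((layeredGraph P (Fin q × X)).comap e).minDegree : ℝ) := by
    have h1 := card_le_minDegree_comap_layeredGraph (P := P) e hk
    rw [Fintype.card_prod, Fintype.card_fin, hX] at h1
    calc γ * (n : ℝ) = γ * ((2 * k + 1) * (q + 1)) * m := by rw [hn]; push_cast; ring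
      _ ≤ q * m := by gcongr
      _ ≤ _ := by exact_mod_cast h1
  have hcopies : (((layeredGraph P (Fin q × X)).comap e).copyCount
      (SimpleGraph.cycleGraph (2 * k + 1)) : ℝ) <
        δ * (n : ℝ) ^ Fintype.card (Fin (2 * k + 1)) := by
    have h1 := copyCount_comap_layeredGraph_le e hk hP
    rw [hT] at h1
    rw [Fintype.card_fin]
    refine lt_of_le_of_lt ?_ hδ
    exact_mod_cast h1
  obtain ⟨F, -, hF, hfree⟩ := h n ((layeredGraph P (Fin q × X)).comap e)
    (by convert hdeg) hcopies
  refine le_trans ?_ hF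
  have hcard := card_le_of_free_deleteEdges_comap e hk hP hfree
  rw [hT] at hcard
  exact_mod_cast hcard

theorem exists_nat_mul_succ_le {a : ℝ} (ha : a < 1) : ∃ q : ℕ, a * (q + 1) ≤ q := by
  obtain ⟨q, hq⟩ := exists_nat_ge (a / (1 - a))
  rw [div_le_iff₀ (by linarith)] at hq
  exact ⟨q, by linarith⟩

/-- Below `1 / (2 k + 1)` the removal function is not polynomially bounded from below. -/
theorem exists_removalDelta_cycleGraph_lt {k : ℕ} (hk : 0 < k) {γ : ℝ}
    (hγ : γ < 1 / (2 * k + 1)) {μ : ℝ} (hμ : 0 < μ) :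
    ∃ ε ∈ Set.Ioo (0 : ℝ) 1,
      removalDelta (SimpleGraph.cycleGraph (2 * k + 1)) ε γ < μ * ε ^ (1 / μ) := by
  have hN0 : (0 : ℝ) < 2 * k + 1 := by positivity
  obtain ⟨q, hq⟩ := exists_nat_mul_succ_le ((lt_div_iff₀ hN0).1 hγ)
  -- With this `D`, `d ^ D` exceeds `(d ^ 2) ^ (1 / μ)` by a spare factor `d`, which absorbs all
  -- constants once `d` is large.
  obtain ⟨D, hD⟩ := exists_nat_ge (2 / μ + 1)
  have hDpos : (0 : ℝ) < D := lt_of_lt_of_le (by positivity) hD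
  -- `A` is the constant in `A / d ^ 2 ≤ ε`, obtained from a sphere of at least `d ^ D / (D * d ^
  -- 2)` points.
  let A : ℝ := 1 / (2 * (2 * k + 1) ^ 2 * (q + 1) ^ 2 * (D * (2 * k + 1) ^ D))
  have hA : 0 < A := by positivity
  obtain ⟨d, hd⟩ := exists_nat_gt (max 1 (2 * (2 * k + 1) / (μ * A ^ (1 / μ))))
  have hd1 : (1 : ℝ) < d := (le_max_left _ _).trans_lt hd
  have hdA : 2 * (2 * k + 1) < d * (μ * A ^ (1 / μ)) :=
    (div_lt_iff₀ (by positivity)).1 ((le_max_right _ _).trans_lt hd)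
  have hdpos : 0 < d := by exact_mod_cast zero_lt_one.trans hd1
  have hd0 : (0 : ℝ) < d := by exact_mod_cast hdpos
  obtain ⟨R, hR⟩ := Behrend.exists_large_sphere D d
  set s : ℕ := (Behrend.sphere D d R).card with hs
  obtain ⟨m, hm⟩ : ∃ m, m = ((2 * k + 1) * d) ^ D := ⟨_, rfl⟩
  obtain ⟨n, hn⟩ : ∃ n, n = (2 * k + 1) * ((q + 1) * m) := ⟨_, rfl⟩
  have hmR : (m : ℝ) = (2 * k + 1) ^ D * d ^ D := by rw [hm]; push_cast; exact mul_pow _ _ _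
  have hnR : (n : ℝ) = (2 * k + 1) * ((q + 1) * m) := by rw [hn]; push_cast; ring
  have hN1 : (1 : ℝ) ≤ 2 * k + 1 := by linarith [Nat.cast_nonneg (α := ℝ) k]
  have hdm : (d : ℝ) ^ D ≤ m := by
    rw [hmR]
    exact le_mul_of_one_le_left (by positivity) (one_le_pow₀ hN1)
  have hm1 : (1 : ℝ) ≤ m := (one_le_pow₀ hd1.le).trans hdm
  have hm0 : (0 : ℝ) < m := by linarith
  have hmn : (m : ℝ) ≤ n := by
    rw [hnR, ← mul_assoc]
    refine le_mul_of_one_le_left hm0.le (one_le_mul_of_one_le_of_one_le hN1 ?_)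
    linarith [Nat.cast_nonneg (α := ℝ) q]
  have hn0 : (0 : ℝ) < n := hm0.trans_le hmn
  push_cast at hR
  have hs0 : (0 : ℝ) < s := lt_of_lt_of_le (by positivity) hR
  have hsm : (s : ℝ) ≤ m := by
    refine le_trans ?_ hdm
    have := Finset.card_le_card (Behrend.sphere_subset_box (n := D) (d := d) (k := R))
    rw [Behrend.card_box] at this
    exact_mod_cast this
  -- Half the packing: `ε * n ^ 2 = m * s / 2` deletions cannot meet `m * s` edge-disjoint cycles.
  set ε : ℝ := m * s / (2 * n ^ 2) with hε
  have hε0 : 0 < ε := by positivity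
  have hε1 : ε < 1 := by
    rw [hε, div_lt_one (by positivity)]
    nlinarith [mul_le_mul_of_nonneg_left hsm hm0.le, pow_le_pow_left₀ hm0.le hmn 2,
      pow_pos hn0 2]
  have hAε : A / d ^ 2 ≤ ε := by
    calc A / d ^ 2 = ((d : ℝ) ^ D / (D * d ^ 2)) / (2 * (2 * k + 1) ^ 2 * (q + 1) ^ 2 * m) := by
          simp only [A]
          rw [hmR]
          field_simp
      _ ≤ (s : ℝ) / (2 * (2 * k + 1) ^ 2 * (q + 1) ^ 2 * m) := by gcongr
      _ = ε := by
          rw [hε, hnR]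
          field_simp
  have hpow : (d : ℝ) ^ (2 / μ) * d ≤ m := by
    calc (d : ℝ) ^ (2 / μ) * d = (d : ℝ) ^ (2 / μ + 1) := by rw [Real.rpow_add_one hd0.ne']
      _ ≤ (d : ℝ) ^ (D : ℝ) := Real.rpow_le_rpow_of_exponent_le hd1.le hD
      _ = (d : ℝ) ^ D := Real.rpow_natCast _ _
      _ ≤ m := hdm
  have hApow : A ^ (1 / μ) ≤ ε ^ (1 / μ) * (d : ℝ) ^ (2 / μ) := by
    have h1 : ((d : ℝ) ^ 2) ^ (1 / μ) = (d : ℝ) ^ (2 / μ) := by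
      rw [← Real.rpow_natCast, ← Real.rpow_mul hd0.le]
      congr 1
      push_cast
      ring
    rw [← h1, ← Real.mul_rpow hε0.le (by positivity)]
    exact Real.rpow_le_rpow hA.le ((div_le_iff₀ (by positivity)).1 hAε) (by positivity)
  refine ⟨ε, ⟨hε0, hε1⟩, ?_⟩
  by_contra! hle
  have hcount : 2 * (2 * k + 1) * (m * s) <
      removalDelta (SimpleGraph.cycleGraph (2 * k + 1)) ε γ * (n : ℝ) ^ (2 * k + 1) := by
    calc 2 * (2 * k + 1) * (m * s : ℝ) ≤ 2 * (2 * k + 1) * (m * m) := by gcongr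
      _ < d * (μ * A ^ (1 / μ)) * (m * m) := by gcongr
      _ ≤ d * (μ * (ε ^ (1 / μ) * (d : ℝ) ^ (2 / μ))) * (m * m) := by gcongr
      _ = μ * ε ^ (1 / μ) * ((d : ℝ) ^ (2 / μ) * d) * (m * m) := by ring
      _ ≤ μ * ε ^ (1 / μ) * m * (m * m) := by gcongr
      _ = μ * ε ^ (1 / μ) * (m : ℝ) ^ 3 := by ring
      _ ≤ μ * ε ^ (1 / μ) * (m : ℝ) ^ (2 * k + 1) := by
          gcongr
          -- `k > 0` enters as `3 ≤ 2 * k + 1`.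
          omega
      _ ≤ removalDelta (SimpleGraph.cycleGraph (2 * k + 1)) ε γ * (n : ℝ) ^ (2 * k + 1) := by
          have := hle.trans' (by positivity)
          gcongr
  have hfar := RemovalAdmissible.card_sphere_le hk (isGreatest_removalDelta _ ε γ).1.2
    (by rwa [← mul_assoc]) hdpos R hm hn hcount
  rw [← hs] at hfar
  have hhalf : ε * (n : ℝ) ^ 2 = m * s / 2 := by rw [hε]; field_simp
  rw [hhalf] at hfar
  linarith [mul_pos hm0 hs0]

theorem theorem4p3 (k : ℕ) (hk : 0 < k) :
    (1 : ℝ) / (2 * (k : ℝ) + 1) ≤ polyRem (SimpleGraph.cycleGraph (2 * k + 1)) := by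
  refine le_csInf ⟨1, one_mem_polyRem_set _⟩ ?_
  rintro γ ⟨-, μ, hμ, h⟩
  by_contra! hγ
  obtain ⟨ε, hε, hlt⟩ := exists_removalDelta_cycleGraph_lt hk hγ hμ
  exact absurd (h ε hε) (not_le.2 hlt)
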